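/- Let $d\ge 1$ and let $gl(d,\mathbb{C})$ be the Lie algebra of all complex $d\times d$ matrices with $[A,B]=AB-BA$. A projector is a Hermitian idempotent matrix. A SIC set in dimension $d$ is a family $\Pi_1,\dots,\Pi_{d^2}$ of rank-$1$ projectors on $\mathbb{C}^d$ with $\mathrm{Tr}(\Pi_r\Pi_s)=\frac{1}{d+1}$ for all $r\neq s$ (and $\mathrm{Tr}(\Pi_r^2)=1$); a SIC-POVM in dimension $d$ is a family of the form $E_r=\frac1d\Pi_r$ ($1\le r\le d^2$) with $\Pi_r$ a SIC set. Let $L_1,\dots,L_{d^2}$ be Hermitian matrices forming a basis of $gl(d,\mathbb{C})$. Let $C_{rst}$ be the structure constants relative to this basis, so that $[L_r,L_s]=\sum_{t=1}^{d^2}C_{rst}L_t$, and let $C_r$ be the $d^2\times d^2$ matrix with entries $(C_r)_{st}=C_{rst}$. Then the following statements are equivalent: (1) For each $r$, $C_r=P_r-P_r^{\mathrm T}$, where $P_r$ is a projector of rank $d-1$ that is orthogonal to its own transpose, i.e. $P_rP_r^{\mathrm T}=0$ (the $Q$-$Q^{\mathrm T}$ property). (2) There exist a SIC set $\Pi_1,\dots,\Pi_{d^2}$,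 signs $\epsilon_r=\pm1$ and a real constant $\alpha\neq-\frac1d$ such that $L_r=\epsilon_r(\Pi_r+\alpha I)$ for all $r$. In particular, a SIC-POVM exists in dimension $d$ if and only if $gl(d,\mathbb{C})$ has a basis of Hermitian matrices with the $Q$-$Q^{\mathrm T}$ property (1). -/

import Mathlib

open scoped Matrix

/-- An orthogonal projector on `ℂⁿ`, i.e. a Hermitian idempotent matrix, of rank `k`. -/
def IsProjectorOfRank {n : Type*} [Fintype n] [DecidableEq n]
    (P : Matrix n n ℂ) (k : ℕ) : Prop :=
  P.IsHermitian ∧ P * P = P ∧ P.rank = k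

/-- A SIC set in dimension `d`: a family of `d²` rank-one projectors `Π_r` such that
`Tr (Π_r Π_s)` is `1` for `r = s` and `1 / (d + 1)` for `r ≠ s`. -/
def IsSICSet {d : ℕ} (Pi : Fin (d ^ 2) → Matrix (Fin d) (Fin d) ℂ) : Prop :=
  (∀ r, IsProjectorOfRank (Pi r) 1) ∧
    ∀ r s, (Pi r * Pi s).trace = if r = s then 1 else 1 / ((d : ℂ) + 1)

/-- A SIC-POVM in dimension `d`: `d²` operators of the form `E_r = Π_r / d`, where the `Π_r`
form a SIC set. -/
def IsSICPOVM {d : ℕ} (E : Fin (d ^ 2) → Matrix (Fin d) (Fin d) ℂ) : Prop :=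
  ∃ Pi : Fin (d ^ 2) → Matrix (Fin d) (Fin d) ℂ,
    IsSICSet Pi ∧ ∀ r, E r = (1 / (d : ℂ)) • Pi r

/-- The structure constants of `gl(d, ℂ)` in the basis `L`: the coefficients `C_{rst}` in
`[L_r, L_s] = ∑ t, C_{rst} L_t`. -/
noncomputable def structureConstant {d : ℕ}
    (L : Module.Basis (Fin (d ^ 2)) ℂ (Matrix (Fin d) (Fin d) ℂ)) (r s t : Fin (d ^ 2)) : ℂ :=
  L.repr ⁅L r, L s⁆ t

/-- The adjoint-representation matrix `C_r` of `L_r` in the basis `L`, `(C_r)_{st} = C_{rst}`. -/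
noncomputable def adjointMatrix {d : ℕ}
    (L : Module.Basis (Fin (d ^ 2)) ℂ (Matrix (Fin d) (Fin d) ℂ)) (r : Fin (d ^ 2)) :
    Matrix (Fin (d ^ 2)) (Fin (d ^ 2)) ℂ :=
  Matrix.of fun s t => structureConstant L r s t

/-- The `Q`-`Qᵀ` property of the basis `L`: every adjoint matrix is `P - Pᵀ` with `P` a projector
of rank `d - 1` that is orthogonal to its own transpose. -/
def HasQQTProperty {d : ℕ}
    (L : Module.Basis (Fin (d ^ 2)) ℂ (Matrix (Fin d) (Fin d) ℂ)) : Prop :=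
  ∀ r, ∃ P : Matrix (Fin (d ^ 2)) (Fin (d ^ 2)) ℂ,
    IsProjectorOfRank P (d - 1) ∧ P * Pᵀ = 0 ∧ adjointMatrix L r = P - Pᵀ

/-! The form P - Pᵀ amounts to four conditions on C_r: Hermitian, antisymmetric, C³ = C, and a
prescribed Tr C². The last two depend only on ad L_r and force the Hermitian L_r to be ±(P_r + a_r)
with P_r a rank-one projector (`Matrix.IsHermitian.exists_rank_one_projector`). Antisymmetry ties
different r together: it makes X ↦ ∑ Tr(X L_s) L_s commute with every ad A, so by a Schur-type lemma
(`Matrix.exists_smul_add_trace_smul_of_commutator`) this map is pX + q Tr(X)·1, which determines the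
Gram matrix. Put x_r = 1 + d a_r and let d > 1. The diagonal makes x_r² constant and p = d/(d+1);
the off-diagonal entries then give Tr(P_r P_s) = 1/(d+1) once x_r = x_s. Equality of these signs is
the delicate point: for d > 2 it follows from ∑ P_s being scalar, for d = 2 from the freedom to
exchange P and 1 - P. Conversely, the Gram matrix of a shifted, signed SIC set is a multiple of the
identity plus a rank-one term. Tracelessness of commutators removes that term, so C_rst is
proportional to Tr([L_r, L_s] L_t), and cyclicity gives its symmetries. -/

/-! ### Projectors and the form P - Pᵀ. -/

theorem Matrix.natCast_rank_eq_trace {n : Type*} [Fintype n] [DecidableEq n]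
    {P : Matrix n n ℂ} (hP : P * P = P) : (P.rank : ℂ) = P.trace := by
  have h : IsIdempotentElem (Matrix.toLin' P) := by
    rw [IsIdempotentElem, Module.End.mul_eq_comp, ← Matrix.toLin'_mul, hP]
  have h2 := (LinearMap.IsIdempotentElem.isProj_range _ h).trace
  rw [Matrix.trace_toLin'_eq] at h2
  rw [h2, Matrix.rank, ← Matrix.toLin'_apply']

theorem isProjectorOfRank_of_trace {n : Type*} [Fintype n] [DecidableEq n]
    {P : Matrix n n ℂ} {k : ℕ} (hH : P.IsHermitian) (hP : P * P = P) (ht : P.trace = k) :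
    IsProjectorOfRank P k :=
  ⟨hH, hP, by exact_mod_cast (Matrix.natCast_rank_eq_trace hP).trans ht⟩

theorem IsProjectorOfRank.trace_eq {n : Type*} [Fintype n] [DecidableEq n]
    {P : Matrix n n ℂ} {k : ℕ} (h : IsProjectorOfRank P k) : P.trace = k := by
  rw [← Matrix.natCast_rank_eq_trace h.2.1, h.2.2]

/-- A matrix is a difference `P - Pᵀ` of mutually orthogonal projectors of rank `k` exactly when it
is Hermitian, antisymmetric, has spectrum in `{0, 1, -1}`, and has the corresponding trace
of its square. -/
theorem exists_projector_sub_transpose_iff {n : Type*} [Fintype n] [DecidableEq n]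
    (C : Matrix n n ℂ) (k : ℕ) :
    (∃ P : Matrix n n ℂ, IsProjectorOfRank P k ∧ P * Pᵀ = 0 ∧ C = P - Pᵀ) ↔
      C.IsHermitian ∧ Cᵀ = -C ∧ C * C * C = C ∧ (C * C).trace = 2 * k := by
  constructor
  · rintro ⟨P, hP, h0, rfl⟩
    -- For Hermitian P the transpose is the entrywise conjugate, so this is the conjugate of P Pᵀ =
    -- 0.
    have hT : Pᵀ * P = 0 := by
      have h1 : Pᵀ = P.map (starRingEnd ℂ) := by
        conv_lhs => rw [← hP.1.eq]
        rfl
      have h2 : P = Pᵀ.map (starRingEnd ℂ) := hP.1.eq.symm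
      calc Pᵀ * P = P.map (starRingEnd ℂ) * Pᵀ.map (starRingEnd ℂ) := by rw [← h1, ← h2]
        _ = 0 := by rw [← Matrix.map_mul, h0, Matrix.map_zero _ (map_zero _)]
    have hI := hP.2.1
    have hIT : Pᵀ * Pᵀ = Pᵀ := by rw [← Matrix.transpose_mul, hI]
    have hsq : (P - Pᵀ) * (P - Pᵀ) = P + Pᵀ := by
      rw [sub_mul, mul_sub, mul_sub, hI, h0, hT, hIT]; abel
    refine ⟨hP.1.sub hP.1.transpose, by simp, ?_, ?_⟩
    · rw [hsq, add_mul, mul_sub, mul_sub, hI, h0, hT, hIT]; abel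
    · rw [hsq, Matrix.trace_add, Matrix.trace_transpose, hP.trace_eq]; ring
  · rintro ⟨hH, hT, h3, ht⟩
    have h4 : C * C * (C * C) = C * C := by rw [← mul_assoc, h3]
    have h3' : C * (C * C) = C := by rw [← mul_assoc, h3]
    have hTT : ((1 / 2 : ℂ) • (C * C + C))ᵀ = (1 / 2 : ℂ) • (C * C - C) := by
      rw [Matrix.transpose_smul, Matrix.transpose_add, Matrix.transpose_mul, hT, neg_mul_neg,
        sub_eq_add_neg]
    -- The spectral projector of C for the eigenvalue 1; transposition sends C to -C, hence yields
    -- the one for -1.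
    refine ⟨(1 / 2 : ℂ) • (C * C + C), isProjectorOfRank_of_trace ?_ ?_ ?_, ?_, ?_⟩
    · rw [Matrix.IsHermitian, Matrix.conjTranspose_smul, Matrix.conjTranspose_add,
        Matrix.conjTranspose_mul, hH.eq]
      simp
    · rw [smul_mul_smul_comm, add_mul, mul_add, mul_add, h4, h3, h3']
      module
    · rw [Matrix.trace_smul, Matrix.trace_add, ht]
      have : C.trace = 0 := by
        have h := congrArg Matrix.trace hT
        rw [Matrix.trace_transpose, Matrix.trace_neg] at h
        linear_combination h / 2
      rw [this, smul_eq_mul]; ring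
    · rw [hTT, smul_mul_smul_comm, add_mul, mul_sub, mul_sub, h4, h3, h3']
      module
    · rw [hTT]; module

/-! ### Inner derivations and their traces. -/

/-- The map `X ↦ A * X - X * A`. -/
noncomputable def Matrix.adLinear {n : Type*} [Fintype n] (A : Matrix n n ℂ) :
    Module.End ℂ (Matrix n n ℂ) :=
  LinearMap.mulLeft ℂ A - LinearMap.mulRight ℂ A

theorem Matrix.adLinear_apply {n : Type*} [Fintype n] (A X : Matrix n n ℂ) :
    A.adLinear X = A * X - X * A := rfl

theorem Matrix.trace_mulLeft_mulRight {n : Type*} [Fintype n] [DecidableEq n]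
    (A B : Matrix n n ℂ) :
    LinearMap.trace ℂ _ (LinearMap.mulLeft ℂ A * LinearMap.mulRight ℂ B) = A.trace * B.trace := by
  rw [LinearMap.trace_eq_matrix_trace ℂ (Matrix.stdBasis ℂ n n), Matrix.trace, Matrix.trace,
    Matrix.trace, Finset.sum_mul_sum, Fintype.sum_prod_type]
  refine Finset.sum_congr rfl fun i _ => Finset.sum_congr rfl fun j _ => ?_
  rw [Matrix.diag_apply, LinearMap.toMatrix_apply, Matrix.stdBasis_eq_single]
  change (A * (Matrix.single i j (1 : ℂ) * B) : Matrix n n ℂ) i j = _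
  rw [← mul_assoc]
  simp [Matrix.mul_apply, Matrix.single_apply, ite_and]

theorem Matrix.trace_adLinear_sq {d : ℕ} (A : Matrix (Fin d) (Fin d) ℂ) :
    LinearMap.trace ℂ _ (A.adLinear * A.adLinear) =
      2 * d * (A * A).trace - 2 * A.trace ^ 2 := by
  have h : A.adLinear * A.adLinear = LinearMap.mulLeft ℂ (A * A) * LinearMap.mulRight ℂ 1
      + LinearMap.mulLeft ℂ 1 * LinearMap.mulRight ℂ (A * A)
      - (2 : ℂ) • (LinearMap.mulLeft ℂ A * LinearMap.mulRight ℂ A) := by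
    ext1 X
    simp only [Module.End.mul_apply, Matrix.adLinear_apply, LinearMap.add_apply,
      LinearMap.sub_apply, LinearMap.mulLeft_apply,
      LinearMap.mulRight_apply, two_smul]
    noncomm_ring
  rw [h, map_sub, map_add, map_smul]
  simp only [Matrix.trace_mulLeft_mulRight, Matrix.trace_one, Fintype.card_fin, smul_eq_mul]
  ring

/-! ### Adjoint matrices in a basis. -/

section Adjoint

variable {d : ℕ} (L : Module.Basis (Fin (d ^ 2)) ℂ (Matrix (Fin d) (Fin d) ℂ))

theorem adjointMatrix_eq_toMatrix_transpose (r : Fin (d ^ 2)) :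
    adjointMatrix L r = (LinearMap.toMatrix L L (L r).adLinear)ᵀ := by
  ext s t
  rw [Matrix.transpose_apply, LinearMap.toMatrix_apply]
  rfl

theorem adjointMatrix_mul_self_mul_self_iff (r : Fin (d ^ 2)) :
    adjointMatrix L r * adjointMatrix L r * adjointMatrix L r = adjointMatrix L r ↔
      (L r).adLinear * (L r).adLinear * (L r).adLinear = (L r).adLinear := by
  rw [adjointMatrix_eq_toMatrix_transpose, ← Matrix.transpose_mul, ← Matrix.transpose_mul,
    Matrix.transpose_inj, ← LinearMap.toMatrix_mul, ← LinearMap.toMatrix_mul,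
    (LinearMap.toMatrix L L).injective.eq_iff, mul_assoc]

theorem trace_adjointMatrix_mul_self (r : Fin (d ^ 2)) :
    (adjointMatrix L r * adjointMatrix L r).trace =
      2 * d * (L r * L r).trace - 2 * (L r).trace ^ 2 := by
  rw [adjointMatrix_eq_toMatrix_transpose, ← Matrix.transpose_mul, Matrix.trace_transpose,
    ← LinearMap.toMatrix_mul, ← LinearMap.trace_eq_matrix_trace, Matrix.trace_adLinear_sq]

/-- The cube and trace conditions are basis-free; only Hermiticity and antisymmetry still see the
whole basis. -/
theorem hasQQTProperty_iff (hd : 1 ≤ d) :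
    HasQQTProperty L ↔ ∀ r, (adjointMatrix L r).IsHermitian ∧
      (adjointMatrix L r)ᵀ = -adjointMatrix L r ∧
      (L r).adLinear * (L r).adLinear * (L r).adLinear = (L r).adLinear ∧
      d * (L r * L r).trace - (L r).trace ^ 2 = d - 1 := by
  refine forall_congr' fun r => ?_
  rw [exists_projector_sub_transpose_iff, adjointMatrix_mul_self_mul_self_iff,
    trace_adjointMatrix_mul_self, Nat.cast_sub hd, Nat.cast_one]
  refine and_congr_right fun _ => and_congr_right fun _ => and_congr_right fun _ =>
    ⟨fun h => ?_, fun h => ?_⟩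
  · linear_combination h / 2
  · linear_combination 2 * h

theorem mul_sub_mul_eq_sum_adjointMatrix (r s : Fin (d ^ 2)) :
    L r * L s - L s * L r = ∑ t, adjointMatrix L r s t • L t :=
  (L.sum_repr ⁅L r, L s⁆).symm

end Adjoint

/-! ### Schur-type lemma for the adjoint representation. -/

/-- An endomorphism commuting with all inner derivations of the matrix algebra acts on
matrices as a combination of the identity and the trace. -/
theorem Matrix.exists_smul_add_trace_smul_of_commutator {d : ℕ}
    (Φ : Matrix (Fin d) (Fin d) ℂ →ₗ[ℂ] Matrix (Fin d) (Fin d) ℂ)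
    (hΦ : ∀ A X, Φ (A * X - X * A) = A * Φ X - Φ X * A) :
    ∃ p q : ℂ, ∀ X, Φ X = p • X + (q * X.trace) • 1 := by
  rcases lt_or_ge d 2 with h2 | h2
  · have hs : ∀ X : Matrix (Fin d) (Fin d) ℂ, X = X.trace • 1 := by
      intro X
      interval_cases d
      · ext i; exact i.elim0
      · ext i j
        fin_cases i; fin_cases j; simp [Matrix.trace]
    refine ⟨0, (Φ 1).trace, fun X => ?_⟩
    conv_lhs => rw [hs X, map_smul, hs (Φ 1), smul_smul, mul_comm]
    rw [zero_smul, zero_add]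
  let E (i j : Fin d) : Matrix (Fin d) (Fin d) ℂ := Matrix.single i j 1
  have hE : ∀ i j k l, E i j * E k l = if j = k then E i l else 0 := by
    intro i j k l
    split_ifs with h
    · subst h; simp [E]
    · simp [E, h]
  let a : Fin d := ⟨0, by omega⟩
  let b : Fin d := ⟨1, by omega⟩
  have hab : a ≠ b := by simp [a, b]
  -- E_ab spans the joint eigenspace of ad E_aa and ad E_bb for the eigenvalues 1 and -1, which Φ
  -- preserves.
  obtain ⟨p, hp⟩ : ∃ p : ℂ, Φ (E a b) = p • E a b := by
    refine ⟨Φ (E a b) a b, ?_⟩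
    have h1 := hΦ (E a a) (E a b)
    have h2 := hΦ (E b b) (E a b)
    simp only [hE, hab.symm, if_true, if_false, sub_zero, zero_sub, map_neg] at h1 h2
    set M := Φ (E a b)
    ext i j
    have e1 := congrFun (congrFun h1 i) j
    have e2 := congrFun (congrFun h2 i) j
    simp only [E, Matrix.sub_apply, Matrix.neg_apply, Matrix.single_mul_eq_updateRow_zero,
      Matrix.mul_single_eq_updateCol_zero, Matrix.smul_apply, Matrix.single_apply] at e1 e2 ⊢
    by_cases hi : i = a
    · by_cases hj : j = b
      · subst hi hj; simp
      · subst hi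
        simp [Matrix.updateRow_apply, hj, hab] at e2
        simp [Ne.symm hj, e2]
    · simp [Matrix.updateRow_apply, Matrix.updateCol_apply, hi] at e1
      simp [Ne.symm hi]
      by_cases hj : j = a
      · subst hj; simp at e1; linear_combination e1 / 2
      · simpa [hj] using e1
  -- The space where Φ acts as p is stable under commutators, so it spreads from E_ab to all
  -- off-diagonal units and to the differences E_kk - E_ll.
  have hker : ∀ A X, Φ X = p • X → Φ (A * X - X * A) = p • (A * X - X * A) := by
    intro A X h
    rw [hΦ, h]; simp [smul_sub]
  have hker' : ∀ A X, Φ X = p • X → Φ (X * A - A * X) = p • (X * A - A * X) := by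
    intro A X h
    rw [← neg_sub, map_neg, hker A X h, smul_neg]
  have hk : ∀ k, k ≠ b → Φ (E k b) = p • E k b := by
    intro k hk
    have h := hker (E k a) _ hp
    simpa [hE, hk.symm] using h
  have hkl : ∀ k l, k ≠ b → k ≠ l → Φ (E k l) = p • E k l := by
    intro k l h1 h2
    have h := hker' (E b l) _ (hk k h1)
    simpa [hE, h2.symm] using h
  have hH := hker' (E b a) _ hp
  simp only [hE, if_true] at hH
  have hoff : ∀ k l, k ≠ l → Φ (E k l) = p • E k l := by
    intro k l h
    by_cases h1 : k = b
    · subst h1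
      have h' := hker' (E b l) _ hH
      by_cases hl : l = a
      · subst hl
        simp only [sub_mul, mul_sub, hE, hab, if_true, if_false] at h'
        have e : (0 - E b a - (E b a - 0)) = (-2 : ℂ) • E b a := by module
        rw [e, map_smul, smul_comm] at h'
        exact smul_right_injective _ (by norm_num : (-2 : ℂ) ≠ 0) h'
      · simpa [sub_mul, mul_sub, hE, hab, hl, h.symm] using h'
    · exact hkl k l h1 h
  have hdiag : ∀ k l, Φ (E k k) - p • E k k = Φ (E l l) - p • E l l := by
    intro k l
    by_cases h : k = l
    · rw [h]
    · have h' := hker' (E l k) _ (hoff k l h)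
      simp only [hE, if_true, map_sub, smul_sub] at h'
      rw [sub_eq_sub_iff_add_eq_add] at h' ⊢
      rw [h', add_comm]
  set Z := Φ (E a a) - p • E a a with hZ
  have hall : ∀ X, Φ X = p • X + X.trace • Z := by
    have : Φ = p • LinearMap.id + (Matrix.traceLinearMap (Fin d) ℂ ℂ).smulRight Z := by
      apply (Matrix.stdBasis ℂ (Fin d) (Fin d)).ext
      rintro ⟨i, j⟩
      rw [Matrix.stdBasis_eq_single]
      simp only [LinearMap.add_apply, LinearMap.smul_apply, LinearMap.id_apply,
        LinearMap.smulRight_apply, Matrix.traceLinearMap_apply]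
      by_cases h : i = j
      · subst h
        rw [Matrix.trace_single_eq_same, one_smul, hZ, ← hdiag i a]
        simp [E]
      · rw [Matrix.trace_single_eq_of_ne _ _ _ h, zero_smul, add_zero]
        exact hoff i j h
    intro X
    conv_lhs => rw [this]
    rfl
  -- Commutators have trace zero, so Φ acts on [E_ij, E_aa] as p alone; equivariance then makes Z
  -- commute with E_ij.
  obtain ⟨q, hq⟩ : Z ∈ Set.range (Matrix.scalar (Fin d)) := by
    apply Matrix.mem_range_scalar_of_commute_single
    intro i j _
    have h := hΦ (E i j) (E a a)
    rw [hall, hall, Matrix.trace_sub, Matrix.trace_mul_comm, sub_self, zero_smul, add_zero] at h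
    rw [show (E a a).trace = 1 from Matrix.trace_single_eq_same _ _, one_smul, mul_add, add_mul,
      mul_smul_comm, smul_mul_assoc, smul_sub] at h
    change E i j * Z = Z * E i j
    rw [← sub_eq_zero]
    have h' := sub_eq_zero.2 h
    rw [← neg_eq_zero, ← h']; abel
  refine ⟨p, q, fun X => ?_⟩
  rw [hall, ← hq, mul_comm, mul_smul, Matrix.scalar_apply, Matrix.smul_one_eq_diagonal]

/-! ### From a SIC set to the `Q`-`Qᵀ` property. -/

theorem Matrix.adLinear_smul_add {n : Type*} [Fintype n] [DecidableEq n] (A : Matrix n n ℂ)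
    (e a : ℂ) : (e • (A + a • (1 : Matrix n n ℂ))).adLinear = e • A.adLinear := by
  ext1 X
  rw [LinearMap.smul_apply, Matrix.adLinear_apply, Matrix.adLinear_apply, smul_mul_assoc,
    mul_smul_comm, add_mul, mul_add, smul_mul_assoc, mul_smul_comm, one_mul, mul_one]
  module

/-- Left and right multiplication by A are commuting idempotents l, r, and (l - r)³ = l - r. -/
theorem Matrix.adLinear_cube_of_idempotent {n : Type*} [Fintype n] [DecidableEq n]
    {A : Matrix n n ℂ} (hA : A * A = A) : A.adLinear * A.adLinear * A.adLinear = A.adLinear := by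
  ext1 X
  have h : ∀ Y : Matrix n n ℂ, A * (A * Y) = A * Y := fun Y => by rw [← mul_assoc, hA]
  simp only [Module.End.mul_apply, Matrix.adLinear_apply, mul_sub, sub_mul, mul_assoc, hA, h]
  abel

/-- Two traces of products of shifted and rescaled matrices of trace one. -/
theorem Matrix.trace_smul_add_mul {d : ℕ} {A B : Matrix (Fin d) (Fin d) ℂ} (hA : A.trace = 1)
    (hB : B.trace = 1) (e f a b : ℂ) :
    ((e • (A + a • (1 : Matrix (Fin d) (Fin d) ℂ))) *
      (f • (B + b • (1 : Matrix (Fin d) (Fin d) ℂ)))).trace =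
      e * f * ((A * B).trace + a + b + d * a * b) := by
  simp only [add_mul, mul_add, smul_mul_assoc, mul_smul_comm, one_mul, mul_one,
    Matrix.trace_smul, Matrix.trace_add, hA, hB, Matrix.trace_one, Fintype.card_fin, smul_eq_mul]
  ring

theorem Matrix.trace_smul_add {d : ℕ} {A : Matrix (Fin d) (Fin d) ℂ} (hA : A.trace = 1)
    (e a : ℂ) : (e • (A + a • (1 : Matrix (Fin d) (Fin d) ℂ))).trace = e * (1 + d * a) := by
  simp only [Matrix.trace_smul, Matrix.trace_add, hA, Matrix.trace_one, Fintype.card_fin,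
    smul_eq_mul]
  ring

theorem IsSICSet.trace_eq_one {d : ℕ} {Pi : Fin (d ^ 2) → Matrix (Fin d) (Fin d) ℂ}
    (h : IsSICSet Pi) (r : Fin (d ^ 2)) : (Pi r).trace = 1 := by
  simpa using (h.1 r).trace_eq

theorem hasQQTProperty_of_isSICSet {d : ℕ} (hd : 1 ≤ d)
    (L : Module.Basis (Fin (d ^ 2)) ℂ (Matrix (Fin d) (Fin d) ℂ))
    (hL : ∀ r, (L r).IsHermitian) {Pi : Fin (d ^ 2) → Matrix (Fin d) (Fin d) ℂ}
    {ε : Fin (d ^ 2) → ℝ} {α : ℝ} (hPi : IsSICSet Pi) (hε : ∀ r, ε r = 1 ∨ ε r = -1)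
    (hα : α ≠ -(1 / (d : ℝ)))
    (hLP : ∀ r, L r = (ε r : ℂ) • (Pi r + (α : ℂ) • (1 : Matrix (Fin d) (Fin d) ℂ))) :
    HasQQTProperty L := by
  have hd0 : (d : ℂ) ≠ 0 := by exact_mod_cast (by omega : d ≠ 0)
  have hd1 : (d : ℂ) + 1 ≠ 0 := by exact_mod_cast (by omega : d + 1 ≠ 0)
  have hx : (1 + d * α : ℂ) ≠ 0 := by
    have hd0' : (d : ℝ) ≠ 0 := by exact_mod_cast (by omega : d ≠ 0)
    intro h
    apply hα
    have h' : (1 + d * α : ℝ) = 0 := by exact_mod_cast h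
    field_simp
    linarith
  have hε2 : ∀ r, (ε r : ℂ) * ε r = 1 := by
    intro r; rcases hε r with h | h <;> simp [h]
  have htr : ∀ r, (L r).trace = ε r * (1 + d * α) := fun r => by
    rw [hLP, Matrix.trace_smul_add (hPi.trace_eq_one r)]
  have hG : ∀ r s, (L r * L s).trace = (if r = s then (d : ℂ) / (d + 1) else 0) +
      ε r * ε s * (1 / (d + 1) + 2 * α + d * α * α) := by
    intro r s
    rw [hLP, hLP, Matrix.trace_smul_add_mul (hPi.trace_eq_one r) (hPi.trace_eq_one s), hPi.2]
    split_ifs with h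
    · subst h
      rw [hε2]; field_simp; ring
    · ring
  -- Take the trace of [L_r, L_s]; the factor 1 + dα cancels because α ≠ -1/d.
  have hsum : ∀ r s, ∑ t, adjointMatrix L r s t * ε t = 0 := by
    intro r s
    have h := congrArg Matrix.trace (mul_sub_mul_eq_sum_adjointMatrix L r s)
    rw [Matrix.trace_sub, Matrix.trace_mul_comm, sub_self, Matrix.trace_sum] at h
    simp only [Matrix.trace_smul, htr, smul_eq_mul, ← mul_assoc, ← Finset.sum_mul] at h
    exact (mul_eq_zero.1 h.symm).resolve_right hx
  have hC : ∀ r s t, adjointMatrix L r s t =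
      (d + 1) / d * ((L r * L s - L s * L r) * L t).trace := by
    intro r s t
    rw [mul_sub_mul_eq_sum_adjointMatrix, Finset.sum_mul, Matrix.trace_sum]
    have : ∀ u, ((adjointMatrix L r s u • L u) * L t).trace =
        (if u = t then adjointMatrix L r s u * ((d : ℂ) / (d + 1)) else 0) +
        adjointMatrix L r s u * ε u * (ε t * (1 / (d + 1) + 2 * α + d * α * α)) := by
      intro u
      rw [smul_mul_assoc, Matrix.trace_smul, hG, smul_eq_mul, mul_add, mul_ite, mul_zero]
      ring
    simp only [this, Finset.sum_add_distrib, ← Finset.sum_mul, hsum, zero_mul, add_zero,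
      Finset.sum_ite_eq', Finset.mem_univ, if_true]
    field_simp
  rw [hasQQTProperty_iff L hd]
  intro r
  refine ⟨?_, ?_, ?_, ?_⟩
  · ext s t
    rw [Matrix.conjTranspose_apply, hC, hC, star_mul', ← Matrix.trace_conjTranspose,
      Matrix.conjTranspose_mul, Matrix.conjTranspose_sub, Matrix.conjTranspose_mul,
      Matrix.conjTranspose_mul, (hL r).eq, (hL s).eq, (hL t).eq, mul_sub, sub_mul,
      Matrix.trace_sub, Matrix.trace_sub, Matrix.trace_mul_comm (L s) (L t * L r),
      Matrix.trace_mul_comm (L s) (L r * L t), mul_assoc (L t), Matrix.trace_mul_comm (L t),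
      mul_assoc (L r) (L t), ← mul_assoc (L r), mul_assoc (L s) (L r) (L t),
      Matrix.trace_mul_comm (L s) (L r * L t), mul_assoc (L r) (L t)]
    simp
  · ext s t
    rw [Matrix.transpose_apply, Matrix.neg_apply, hC, hC, sub_mul, sub_mul, Matrix.trace_sub,
      Matrix.trace_sub, mul_assoc (L t), Matrix.trace_mul_comm (L t), mul_assoc (L s),
      Matrix.trace_mul_comm (L s) (L r * L t)]
    ring
  · rw [hLP, Matrix.adLinear_smul_add, smul_mul_smul_comm, smul_mul_smul_comm, hε2, one_mul,
      Matrix.adLinear_cube_of_idempotent (hPi.1 r).2.1]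
  · rw [hG, htr, hε2, mul_pow, sq (ε r : ℂ), hε2, if_pos rfl]
    field_simp
    ring

/-- The trace of a relation gives ∑ c_r = 0; pairing with Π_s then leaves c_s d/(d+1) = 0. -/
theorem IsSICSet.linearIndependent {d : ℕ} (hd : 1 ≤ d)
    {Pi : Fin (d ^ 2) → Matrix (Fin d) (Fin d) ℂ} (hPi : IsSICSet Pi) :
    LinearIndependent ℂ Pi := by
  have hd0 : (d : ℂ) ≠ 0 := by exact_mod_cast (by omega : d ≠ 0)
  have hd1 : (d : ℂ) + 1 ≠ 0 := by exact_mod_cast (by omega : d + 1 ≠ 0)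
  rw [Fintype.linearIndependent_iff]
  intro c hc s
  have h : ∑ r, c r = 0 := by
    simpa [Matrix.trace_sum, hPi.trace_eq_one] using congrArg Matrix.trace hc
  have h2 := congrArg (fun M => (M * Pi s).trace) hc
  have : ∀ r, c r * (if r = s then 1 else 1 / ((d : ℂ) + 1)) =
      (if r = s then c r * (d / (d + 1)) else 0) + c r * (1 / (d + 1)) := by
    intro r
    split_ifs
    · field_simp
    · ring
  simp only [Finset.sum_mul, Matrix.trace_sum, smul_mul_assoc, Matrix.trace_smul, hPi.2,
    smul_eq_mul, this, Finset.sum_add_distrib, zero_mul, Matrix.trace_zero] at h2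
  rw [← Finset.sum_mul, h, zero_mul, add_zero, Finset.sum_ite_eq' Finset.univ s,
    if_pos (Finset.mem_univ _)] at h2
  exact (mul_eq_zero.1 h2).resolve_right (div_ne_zero hd0 hd1)

theorem IsSICSet.exists_basis {d : ℕ} (hd : 1 ≤ d)
    {Pi : Fin (d ^ 2) → Matrix (Fin d) (Fin d) ℂ} (hPi : IsSICSet Pi) :
    ∃ L : Module.Basis (Fin (d ^ 2)) ℂ (Matrix (Fin d) (Fin d) ℂ), ∀ r, L r = Pi r := by
  have : Nonempty (Fin (d ^ 2)) := ⟨⟨0, by positivity⟩⟩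
  refine ⟨basisOfLinearIndependentOfCardEqFinrank (hPi.linearIndependent hd) ?_, fun r => ?_⟩
  · simp [Module.finrank_matrix, sq]
  · simp

/-! ### Recovering a rank-one projector from its adjoint action. -/

/-- A Hermitian matrix whose adjoint action has spectrum in `{0, 1, -1}` is a projector up to a
real multiple of the identity. -/
theorem Matrix.IsHermitian.exists_projector_add_smul_one {d : ℕ} (hd : 1 ≤ d)
    {A : Matrix (Fin d) (Fin d) ℂ} (hA : A.IsHermitian)
    (h3 : A.adLinear * A.adLinear * A.adLinear = A.adLinear) :
    ∃ (E : Matrix (Fin d) (Fin d) ℂ) (a : ℝ), E.IsHermitian ∧ E * E = E ∧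
      A = E + (a : ℂ) • (1 : Matrix (Fin d) (Fin d) ℂ) := by
  have : Nonempty (Fin d) := ⟨⟨0, hd⟩⟩
  set ev := hA.eigenvalues with hev
  set U : Matrix (Fin d) (Fin d) ℂ := hA.eigenvectorUnitary.1 with hU
  set D : Matrix (Fin d) (Fin d) ℂ := Matrix.diagonal (fun i => (ev i : ℂ)) with hD
  have hUU : star U * U = 1 := Unitary.coe_star_mul_self _
  have hUU' : U * star U = 1 := Unitary.coe_mul_star_self _
  have hAU : A = U * D * star U := hA.spectral_theorem
  have hconj : ∀ X, A.adLinear (U * X * star U) = U * D.adLinear X * star U := by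
    intro X
    rw [Matrix.adLinear_apply, Matrix.adLinear_apply, hAU, mul_sub, sub_mul]
    congr 1
    · calc _ = U * D * (star U * U) * X * star U := by simp only [mul_assoc]
        _ = _ := by rw [hUU]; simp only [mul_assoc, one_mul]
    · calc _ = U * X * (star U * U) * D * star U := by simp only [mul_assoc]
        _ = _ := by rw [hUU]; simp only [mul_assoc, one_mul]
  have hDad : ∀ X, D.adLinear (D.adLinear (D.adLinear X)) = D.adLinear X := by
    intro X
    have h := LinearMap.congr_fun h3 (U * X * star U)
    simp only [Module.End.mul_apply, hconj] at h
    have h' := congrArg (fun M => star U * M * U) h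
    have key : ∀ M, star U * (U * M * star U) * U = M := fun M => by
      calc _ = (star U * U) * M * (star U * U) := by simp only [mul_assoc]
        _ = M := by rw [hUU, one_mul, mul_one]
    simpa only [key] using h'
  have hdiff : ∀ i j, (ev i - ev j) ^ 3 = ev i - ev j := by
    intro i j
    have h := congrFun (congrFun (hDad (Matrix.single i j 1)) i) j
    have hs : ∀ c : ℂ, D.adLinear (Matrix.single i j c) =
        Matrix.single i j ((ev i - ev j) * c) := by
      intro c
      ext k l
      simp only [Matrix.adLinear_apply, hD, Matrix.sub_apply, Matrix.diagonal_mul,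
        Matrix.mul_diagonal, Matrix.single_apply]
      split_ifs with h
      · rw [← h.1, ← h.2]; ring
      · ring
    rw [hs, hs, hs, Matrix.single_apply_same, Matrix.single_apply_same] at h
    have h' : ((ev i - ev j) * ((ev i - ev j) * ((ev i - ev j) * 1)) : ℝ) =
      (ev i - ev j) * 1 := by exact_mod_cast h
    linear_combination h'
  -- Differences from the smallest eigenvalue are nonnegative, which excludes -1 and leaves 0 and 1.
  obtain ⟨m, hm⟩ := Finite.exists_min ev
  have hidem : ∀ i, (ev i - ev m) * (ev i - ev m) = ev i - ev m := by
    intro i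
    have h0 := hm i
    have h := hdiff i m
    have h1 : (ev i - ev m) * (ev i - ev m - 1) * (ev i - ev m + 1) = 0 := by
      linear_combination h
    have h2 := (mul_eq_zero.1 h1).resolve_right (by linarith)
    linear_combination h2
  refine ⟨A - (ev m : ℂ) • 1, ev m, ?_, ?_, by simp⟩
  · rw [Matrix.IsHermitian, Matrix.conjTranspose_sub, hA.eq, Matrix.conjTranspose_smul]
    simp
  · have hE : A - (ev m : ℂ) • 1 = U * (D - (ev m : ℂ) • 1) * star U := by
      rw [mul_sub, sub_mul, ← hAU, mul_smul_comm, mul_one, smul_mul_assoc, hUU']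
    have hDD : (D - (ev m : ℂ) • 1) * (D - (ev m : ℂ) • 1) = D - (ev m : ℂ) • 1 := by
      rw [hD, Matrix.smul_one_eq_diagonal, Matrix.diagonal_sub, Matrix.diagonal_mul_diagonal]
      congr 1
      funext i
      exact_mod_cast hidem i
    rw [hE]
    calc _ = U * ((D - (ev m : ℂ) • 1) * (star U * U) * (D - (ev m : ℂ) • 1)) * star U := by
          simp only [mul_assoc]
      _ = _ := by rw [hUU, mul_one, hDD]

theorem IsProjectorOfRank.one_sub {d : ℕ} {P : Matrix (Fin d) (Fin d) ℂ} {k l : ℕ}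
    (hP : IsProjectorOfRank P k) (hkl : k + l = d) : IsProjectorOfRank (1 - P) l := by
  refine isProjectorOfRank_of_trace (Matrix.isHermitian_one.sub hP.1) ?_ ?_
  · rw [sub_mul, one_mul, mul_sub, hP.2.1, mul_one, sub_self, sub_zero]
  · rw [Matrix.trace_sub, Matrix.trace_one, hP.trace_eq, Fintype.card_fin, ← hkl]
    push_cast; ring

/-- A Hermitian matrix whose adjoint action has eigenvalues `0, 1, -1` with the multiplicities of
a rank-one projector is, up to sign and shift, a rank-one projector. In dimension two the sign can
be chosen to make the trace of the shifted projector nonnegative. -/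
theorem Matrix.IsHermitian.exists_rank_one_projector {d : ℕ} (hd : 1 ≤ d)
    {A : Matrix (Fin d) (Fin d) ℂ} (hA : A.IsHermitian)
    (h3 : A.adLinear * A.adLinear * A.adLinear = A.adLinear)
    (ht : d * (A * A).trace - A.trace ^ 2 = (d : ℂ) - 1) :
    ∃ (P : Matrix (Fin d) (Fin d) ℂ) (e a : ℝ), IsProjectorOfRank P 1 ∧ (e = 1 ∨ e = -1) ∧
      A = (e : ℂ) • (P + (a : ℂ) • (1 : Matrix (Fin d) (Fin d) ℂ)) ∧
      (d = 2 → 0 ≤ 1 + d * a) := by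
  obtain ⟨E, a, hEH, hEE, hAE⟩ := hA.exists_projector_add_smul_one hd h3
  have hEr : IsProjectorOfRank E E.rank := ⟨hEH, hEE, rfl⟩
  set k := E.rank with hk
  have htr := hEr.trace_eq
  have hflip : ∀ P : Matrix (Fin d) (Fin d) ℂ, P + (a : ℂ) • (1 : Matrix (Fin d) (Fin d) ℂ) =
      ((-1 : ℝ) : ℂ) • (1 - P + ((-1 - a : ℝ) : ℂ) • (1 : Matrix (Fin d) (Fin d) ℂ)) := by
    intro P; push_cast; module
  -- The shift a drops out: the left side of `ht` is k(d - k), and k(d - k) = d - 1 factors.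
  have hkd : k = 1 ∨ k + 1 = d := by
    rw [hAE, add_mul, mul_add, mul_add, hEE, smul_mul_smul_comm, mul_smul_comm, smul_mul_assoc,
      one_mul, mul_one] at ht
    simp only [Matrix.trace_add, Matrix.trace_smul, htr, Matrix.trace_one, Fintype.card_fin,
      smul_eq_mul, mul_one] at ht
    have h : ((k : ℂ) - 1) * (k + 1 - d) = 0 := by linear_combination -ht
    rcases mul_eq_zero.1 h with h | h
    · left; exact_mod_cast sub_eq_zero.1 h
    · right; exact_mod_cast sub_eq_zero.1 h
  -- If d = 2 and k = 1, then 1 - E also has rank one, and passing to it negates 1 + da.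
  by_cases hkone : k = 1 ∧ (d = 2 → 0 ≤ 1 + d * a)
  · exact ⟨E, 1, a, hkone.1 ▸ hEr, Or.inl rfl, by simpa using hAE, hkone.2⟩
  · have hk1 : k + 1 = d := by
      rcases hkd with h | h
      · have := not_and.1 hkone h
        push Not at this
        omega
      · exact h
    refine ⟨1 - E, -1, -1 - a, hEr.one_sub hk1, Or.inr rfl, by rw [hAE, hflip], fun h2 => ?_⟩
    have := not_and.1 hkone (by omega)
    push Not at this
    have h' := this.2
    rw [h2] at h' ⊢
    push_cast at h' ⊢
    linarith

/-! ### The Gram matrix under total antisymmetry. -/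

/-- If the structure constants of `gl(d, ℂ)` in a basis are totally antisymmetric, the Gram matrix
of the trace form is a combination of the identity and the matrix of products of traces. -/
theorem exists_trace_mul_eq_of_antisymmetric {d : ℕ} (hd : 1 ≤ d)
    (L : Module.Basis (Fin (d ^ 2)) ℂ (Matrix (Fin d) (Fin d) ℂ))
    (hC : ∀ r, (adjointMatrix L r)ᵀ = -adjointMatrix L r) :
    ∃ p q : ℂ, p + q * d ≠ 0 ∧
      (∀ r s, (p + q * d) * (L r * L s).trace =
        (if r = s then (p + q * d) * p else 0) + q * (L r).trace * (L s).trace) ∧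
      (∑ s, (L s).trace • L s = (p + q * d) • (1 : Matrix (Fin d) (Fin d) ℂ)) ∧
      ∃ κ : ℂ, ∑ s, L s * L s = κ • (1 : Matrix (Fin d) (Fin d) ℂ) := by
  have hanti : ∀ r s t, adjointMatrix L r t s = -adjointMatrix L r s t := fun r s t => by
    simpa using congrFun (congrFun (hC r) s) t
  let Φ : Matrix (Fin d) (Fin d) ℂ →ₗ[ℂ] Matrix (Fin d) (Fin d) ℂ :=
    ∑ s, ((Matrix.traceLinearMap (Fin d) ℂ ℂ) ∘ₗ (LinearMap.mulRight ℂ (L s))).smulRight (L s)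
  have hΦ : ∀ X, Φ X = ∑ s, (X * L s).trace • L s := by
    intro X; simp [Φ, LinearMap.sum_apply]
  have hbasis : ∀ r X, Φ (L r * X - X * L r) = L r * Φ X - Φ X * L r := by
    intro r X
    have h1 : ∀ t, ((L r * X - X * L r) * L t).trace =
        ∑ s, (X * L s).trace * adjointMatrix L r s t := by
      intro t
      have : ((L r * X - X * L r) * L t).trace = -(X * (L r * L t - L t * L r)).trace := by
        rw [sub_mul, mul_sub, Matrix.trace_sub, Matrix.trace_sub, mul_assoc,
          Matrix.trace_mul_comm (L r), mul_assoc, mul_assoc]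
        ring
      rw [this, mul_sub_mul_eq_sum_adjointMatrix, Finset.mul_sum, Matrix.trace_sum,
        ← Finset.sum_neg_distrib]
      refine Finset.sum_congr rfl fun s _ => ?_
      rw [mul_smul_comm, Matrix.trace_smul, smul_eq_mul, hanti r s t]
      ring
    have h2 : L r * Φ X - Φ X * L r = ∑ s, (X * L s).trace • (L r * L s - L s * L r) := by
      rw [hΦ, Finset.mul_sum, Finset.sum_mul, ← Finset.sum_sub_distrib]
      refine Finset.sum_congr rfl fun s _ => ?_
      rw [mul_smul_comm, smul_mul_assoc, smul_sub]
    rw [h2, hΦ]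
    simp only [h1, mul_sub_mul_eq_sum_adjointMatrix, Finset.sum_smul, Finset.smul_sum, smul_smul]
    exact Finset.sum_comm
  have hcomm : ∀ A X, Φ (A * X - X * A) = A * Φ X - Φ X * A := by
    intro A X
    rw [← L.sum_repr A, Finset.sum_mul, Finset.mul_sum, Finset.sum_mul, Finset.mul_sum,
      ← Finset.sum_sub_distrib, ← Finset.sum_sub_distrib, map_sum]
    refine Finset.sum_congr rfl fun r _ => ?_
    rw [smul_mul_assoc, mul_smul_comm, smul_mul_assoc, mul_smul_comm, ← smul_sub, ← smul_sub,
      map_smul, hbasis]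
  obtain ⟨p, q, hpq⟩ := Matrix.exists_smul_add_trace_smul_of_commutator Φ hcomm
  have h1 : ∑ s, (L s).trace • L s = (p + q * d) • (1 : Matrix (Fin d) (Fin d) ℂ) := by
    have h := hpq 1
    rw [hΦ, Matrix.trace_one, Fintype.card_fin, ← add_smul] at h
    simpa only [one_mul] using h
  have hc : ∀ s, (L s).trace = (p + q * d) * L.repr 1 s := by
    intro s
    have h := congrArg (fun M => L.repr M s) h1
    simpa only [map_smul, Finsupp.smul_apply, smul_eq_mul, L.repr_sum_self] using h
  refine ⟨p, q, fun h0 => ?_, fun r s => ?_, h1, p * d + q, ?_⟩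
  -- If p + qd = 0, every basis element is traceless, contradicting Tr 1 = d.
  · have h := congrArg Matrix.trace (L.sum_repr 1)
    simp only [Matrix.trace_sum, Matrix.trace_smul, hc, h0, zero_mul, smul_zero,
      Finset.sum_const_zero, Matrix.trace_one, Fintype.card_fin] at h
    have : d = 0 := by exact_mod_cast h.symm
    omega
  · have h := congrArg (fun M => L.repr M s) ((hΦ (L r)).symm.trans (hpq (L r)))
    simp only [map_smul, map_add, Finsupp.smul_apply, Finsupp.add_apply, smul_eq_mul,
      L.repr_sum_self, L.repr_self, Finsupp.single_apply] at h
    rw [h, hc s]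
    split_ifs <;> ring
  · ext j b
    -- The (i, b) entry of Φ(E_ij); summing over i produces the (j, b) entry of ∑ L_s².
    have h : ∀ i, ∑ s, L s j i * L s i b =
        p * (if j = b then 1 else 0) + if i = j then (if j = b then q else 0) else 0 := by
      intro i
      have h := congrFun (congrFun ((hΦ (Matrix.single i j 1)).symm.trans
        (hpq (Matrix.single i j 1))) i) b
      rw [Matrix.sum_apply] at h
      simp only [Matrix.trace_single_mul, Matrix.smul_apply, Matrix.add_apply, smul_eq_mul,
        one_mul, Matrix.single_apply, true_and] at h
      rw [h]
      by_cases hij : i = j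
      · subst hij
        simp [Matrix.one_apply]
      · simp [Matrix.trace_single_eq_of_ne _ _ _ hij, hij]
    rw [Matrix.sum_apply]
    simp only [Matrix.mul_apply]
    rw [Finset.sum_comm]
    simp only [h, Finset.sum_add_distrib, Matrix.smul_apply, Matrix.one_apply]
    by_cases hjb : j = b <;> simp [hjb, mul_comm]

/-! ### From the `Q`-`Qᵀ` property to a SIC set. -/

theorem exists_isSICSet_of_hasQQTProperty {d : ℕ} (hd : 1 ≤ d)
    (L : Module.Basis (Fin (d ^ 2)) ℂ (Matrix (Fin d) (Fin d) ℂ))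
    (hL : ∀ r, (L r).IsHermitian) (hQ : HasQQTProperty L) :
    ∃ (Pi : Fin (d ^ 2) → Matrix (Fin d) (Fin d) ℂ) (ε : Fin (d ^ 2) → ℝ) (α : ℝ),
      IsSICSet Pi ∧ (∀ r, ε r = 1 ∨ ε r = -1) ∧ α ≠ -(1 / (d : ℝ)) ∧
        ∀ r, L r = (ε r : ℂ) • (Pi r + (α : ℂ) • (1 : Matrix (Fin d) (Fin d) ℂ)) := by
  have hd0 : (d : ℂ) ≠ 0 := by exact_mod_cast (by omega : d ≠ 0)
  have hd0' : (d : ℝ) ≠ 0 := by exact_mod_cast (by omega : d ≠ 0)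
  have hd1 : (d : ℂ) + 1 ≠ 0 := by exact_mod_cast (by omega : d + 1 ≠ 0)
  rw [hasQQTProperty_iff L hd] at hQ
  choose P ε a hP hε hLP hpos using fun r =>
    (hL r).exists_rank_one_projector hd (hQ r).2.2.1 (hQ r).2.2.2
  obtain ⟨p, q, hμ, hG, hlL, κ, hκ⟩ :=
    exists_trace_mul_eq_of_antisymmetric hd L fun r => (hQ r).2.1
  set μ := p + q * d with hμdef
  have hP1 : ∀ r, (P r).trace = 1 := fun r => by simpa using (hP r).trace_eq
  have hPP : ∀ r, P r * P r = P r := fun r => (hP r).2.1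
  have hε2 : ∀ r, (ε r : ℂ) * ε r = 1 := by
    intro r; rcases hε r with h | h <;> simp [h]
  let x : Fin (d ^ 2) → ℝ := fun r => 1 + d * a r
  have hx : ∀ r, (x r : ℂ) = 1 + d * a r := fun r => by simp [x]
  have hl : ∀ r, (L r).trace = ε r * x r := fun r => by
    rw [hLP, Matrix.trace_smul_add (hP1 r), hx]
  have hl2 : ∀ r, (L r).trace ^ 2 = (x r : ℂ) ^ 2 := fun r => by
    rw [hl]; linear_combination (x r : ℂ) ^ 2 * hε2 r
  have hsum : ∑ s, (x s : ℂ) ^ 2 = μ * d := by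
    have h := congrArg Matrix.trace hlL
    simpa [Matrix.trace_sum, ← sq, hl2] using h
  have hne : ∃ r, x r ≠ 0 := by
    by_contra! h
    simp only [h] at hsum
    apply mul_ne_zero hμ hd0
    simpa using hsum.symm
  suffices H : (∀ r s, x r = x s) ∧
      ∀ r s, r ≠ s → (P r * P s).trace = 1 / ((d : ℂ) + 1) by
    obtain ⟨r₀, hr₀⟩ := hne
    have ha : ∀ r, a r = a r₀ := fun r => by
      have h : (1 + d * a r : ℝ) = 1 + d * a r₀ := H.1 r r₀
      exact mul_left_cancel₀ hd0' (add_left_cancel h)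
    refine ⟨P, ε, a r₀, ⟨hP, fun r s => ?_⟩, hε, fun h => hr₀ ?_, fun r => ?_⟩
    · split_ifs with h
      · rw [h, hPP, hP1]
      · exact H.2 r s h
    · simp only [x, h]; field_simp; ring
    · rw [← ha r]; exact hLP r
  rcases Nat.eq_or_lt_of_le hd with h1 | h1
  · have : Subsingleton (Fin (d ^ 2)) := by rw [← h1, one_pow]; infer_instance
    exact ⟨fun r s => by rw [Subsingleton.elim r s],
      fun r s h => absurd (Subsingleton.elim r s) h⟩
  have hdm : (d : ℂ) - 1 ≠ 0 := sub_ne_zero.2 (by exact_mod_cast (by omega : d ≠ 1))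
  -- Eliminate Tr L_r² between the diagonal Gram entry and the trace identity; the right side is
  -- independent of r.
  have hrr : ∀ r, p * (x r : ℂ) ^ 2 = μ * (d * p - (d - 1)) := by
    intro r
    have h := hG r r
    have h' := (hQ r).2.2.2
    rw [if_pos rfl] at h
    have h2 := hl2 r
    linear_combination (d : ℂ) * h - μ * h' - p * h2 - (L r).trace ^ 2 * hμdef
  have hp : p ≠ 0 := by
    rintro rfl
    have h := hrr hne.choose
    have : μ * (d - 1 : ℂ) = 0 := by linear_combination h
    exact mul_ne_zero hμ hdm this
  obtain ⟨r₀, hr₀⟩ := hne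
  have hr₀' : (x r₀ : ℂ) ≠ 0 := by exact_mod_cast hr₀
  set lam : ℂ := (x r₀ : ℂ) ^ 2 with hlam
  have hlam0 : lam ≠ 0 := pow_ne_zero 2 hr₀'
  have hxx : ∀ r, (x r : ℂ) ^ 2 = lam := fun r =>
    mul_left_cancel₀ hp ((hrr r).trans (hrr r₀).symm)
  have hμl : μ = d * lam := by
    simp only [hxx, Finset.sum_const, Finset.card_univ, Fintype.card_fin, nsmul_eq_mul] at hsum
    push_cast at hsum
    apply mul_right_cancel₀ hd0
    rw [← hsum]; ring
  have hpd : p * (d + 1) = d := by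
    have h := hrr r₀
    rw [← hlam, hμl] at h
    apply mul_right_cancel₀ (mul_ne_zero hlam0 hdm)
    linear_combination -h
  have hT : ∀ r s, r ≠ s → lam * (d + 1) * (d * (P r * P s).trace - 1) = -(x r * x s) := by
    intro r s hrs
    have h := hG r s
    rw [if_neg hrs, hl, hl, hLP, hLP, Matrix.trace_smul_add_mul (hP1 r) (hP1 s)] at h
    have hee : (ε r * ε s : ℂ) * (ε r * ε s) = 1 := by
      linear_combination ε r * ε r * hε2 s + hε2 r
    have h2 : μ * ((P r * P s).trace + a r + a s + d * a r * a s) = q * x r * x s := by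
      linear_combination (ε r * ε s : ℂ) * h - (μ * ((P r * P s).trace + a r + a s
        + d * a r * a s) - q * x r * x s) * hee
    have h3 : μ * (d * (P r * P s).trace - 1) = - p * (x r * x s) := by
      rw [hx r, hx s] at h2 ⊢
      linear_combination (d : ℂ) * h2 + (1 + d * a r : ℂ) * (1 + d * a s) * hμdef
    rw [hμl] at h3
    apply mul_left_cancel₀ hd0
    linear_combination (d + 1 : ℂ) * h3 - (x r * x s : ℂ) * hpd
  have hconst : ∀ r s, x r = x s := by
    rcases Nat.eq_or_lt_of_le h1 with h2 | h2
    · intro r s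
      have h : x r ^ 2 = x s ^ 2 := by exact_mod_cast (hxx r).trans (hxx s).symm
      exact (pow_left_inj₀ (hpos r h2.symm) (hpos s h2.symm) two_ne_zero).1 h
    · have hdm2 : (d : ℂ) - 2 ≠ 0 := sub_ne_zero.2 (by exact_mod_cast (by omega : d ≠ 2))
      -- In d L² - 2 Tr(L) L the coefficient of P is d(1 + 2a) - 2(1 + da) = d - 2, and both sums ∑
      -- L_s² and ∑ Tr(L_s) L_s are scalar.
      have hPs : ∀ s, ((d : ℂ) - 2) • P s = (d : ℂ) • (L s * L s) - (2 : ℂ) • ((L s).trace • L s)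
          + ((-d * a s * a s + 2 * x s * a s : ℂ)) • (1 : Matrix (Fin d) (Fin d) ℂ) := by
        intro s
        have hLL : L s * L s = (1 + 2 * a s : ℂ) • P s +
            (a s * a s : ℂ) • (1 : Matrix (Fin d) (Fin d) ℂ) := by
          rw [hLP, smul_mul_smul_comm, hε2, one_smul, add_mul, mul_add, mul_add, hPP,
            smul_mul_smul_comm, mul_smul_comm, smul_mul_assoc]
          simp only [one_mul, mul_one]
          module
        have hlLs : (L s).trace • L s = (x s : ℂ) •
            (P s + (a s : ℂ) • (1 : Matrix (Fin d) (Fin d) ℂ)) := by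
          rw [hl]
          conv_lhs => rw [hLP, smul_smul]
          rw [show (ε s * x s * ε s : ℂ) = x s by linear_combination (x s : ℂ) * hε2 s]
        rw [hLL, hlLs, hx]
        module
      obtain ⟨σ, hσ⟩ : ∃ σ : ℂ, ((d : ℂ) - 2) • ∑ s, P s =
          σ • (1 : Matrix (Fin d) (Fin d) ℂ) := by
        refine ⟨d * κ - 2 * μ + ∑ s, (-d * a s * a s + 2 * x s * a s : ℂ), ?_⟩
        simp only [Finset.smul_sum, hPs]
        rw [Finset.sum_add_distrib, Finset.sum_sub_distrib, ← Finset.smul_sum, hκ,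
          ← Finset.smul_sum, hlL, ← Finset.sum_smul]
        module
      have hσd : σ = (d - 2) * d := by
        have h := congrArg Matrix.trace hσ
        simp only [Matrix.trace_smul, Matrix.trace_sum, hP1, Finset.sum_const, Finset.card_univ,
          Fintype.card_fin, nsmul_eq_mul, Matrix.trace_one, smul_eq_mul] at h
        push_cast at h
        apply mul_right_cancel₀ hd0
        linear_combination -h
      have hsumT : ∀ t, ∑ s, (P s * P t).trace = d := by
        intro t
        have h := congrArg (fun M => (M * P t).trace) hσ
        simp only [smul_mul_assoc, Finset.sum_mul, one_mul, Matrix.trace_smul, Matrix.trace_sum,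
          hP1, smul_eq_mul, hσd] at h
        apply mul_left_cancel₀ hdm2
        linear_combination h
      -- Summing the overlap formula over s gives a value free of t, so every x_t is the same
      -- multiple of 1/∑ x_s.
      have hxS : ∀ t, (x t : ℂ) * ∑ s, (x s : ℂ) = d ^ 2 * lam := by
        intro t
        have h : ∀ s, lam * (d + 1) * (d * (P s * P t).trace - 1) =
            (if s = t then d ^ 2 * lam else 0) - x t * x s := by
          intro s
          split_ifs with hst
          · rw [hst, hPP, hP1]
            linear_combination hxx t
          · rw [hT s t hst]; ring
        have h' := Finset.sum_congr (rfl : (Finset.univ : Finset (Fin (d ^ 2))) = _)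
          fun s _ => h s
        rw [← Finset.mul_sum, Finset.sum_sub_distrib, ← Finset.mul_sum, hsumT,
          Finset.sum_sub_distrib, ← Finset.mul_sum, Finset.sum_ite_eq' Finset.univ t,
          if_pos (Finset.mem_univ _)] at h'
        simp only [Finset.sum_const, Finset.card_univ, Fintype.card_fin, nsmul_eq_mul] at h'
        push_cast at h'
        linear_combination h'
      have hS : (∑ s, (x s : ℂ)) ≠ 0 := by
        intro h0
        have h := hxS r₀
        rw [h0, mul_zero] at h
        exact mul_ne_zero (pow_ne_zero 2 hd0) hlam0 h.symm
      intro r s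
      exact_mod_cast mul_right_cancel₀ hS ((hxS r).trans (hxS s).symm)
  refine ⟨hconst, fun r s hrs => ?_⟩
  have h := hT r s hrs
  rw [hconst s r, ← sq, hxx r] at h
  have h' : (d + 1 : ℂ) * (d * (P r * P s).trace - 1) = -1 :=
    mul_left_cancel₀ hlam0 (by linear_combination h)
  rw [eq_div_iff hd1]
  apply mul_left_cancel₀ hd0
  linear_combination h'

theorem theorem7 (d : ℕ) (hd : 1 ≤ d) :
    (∀ L : Module.Basis (Fin (d ^ 2)) ℂ (Matrix (Fin d) (Fin d) ℂ),
      (∀ r, (L r).IsHermitian) →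
        (HasQQTProperty L ↔
          ∃ (Pi : Fin (d ^ 2) → Matrix (Fin d) (Fin d) ℂ) (ε : Fin (d ^ 2) → ℝ) (α : ℝ),
            IsSICSet Pi ∧ (∀ r, ε r = 1 ∨ ε r = -1) ∧ α ≠ -(1 / (d : ℝ)) ∧
              ∀ r, L r = (ε r : ℂ) • (Pi r + (α : ℂ) • (1 : Matrix (Fin d) (Fin d) ℂ)))) ∧
    ((∃ E : Fin (d ^ 2) → Matrix (Fin d) (Fin d) ℂ, IsSICPOVM E) ↔
      ∃ L : Module.Basis (Fin (d ^ 2)) ℂ (Matrix (Fin d) (Fin d) ℂ),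
        (∀ r, (L r).IsHermitian) ∧ HasQQTProperty L) := by
  refine ⟨fun L hL => ⟨exists_isSICSet_of_hasQQTProperty hd L hL, ?_⟩, ?_, ?_⟩
  · rintro ⟨Pi, ε, α, hPi, hε, hα, hLP⟩
    exact hasQQTProperty_of_isSICSet hd L hL hPi hε hα hLP
  · rintro ⟨E, Pi, hPi, -⟩
    obtain ⟨L, hL⟩ := hPi.exists_basis hd
    have hH : ∀ r, (L r).IsHermitian := fun r => hL r ▸ (hPi.1 r).1
    have hd0 : (d : ℝ) ≠ 0 := by exact_mod_cast (by omega : d ≠ 0)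
    exact ⟨L, hH, hasQQTProperty_of_isSICSet hd L hH hPi (ε := fun _ => 1) (α := 0)
      (fun _ => Or.inl rfl) (neg_ne_zero.2 (one_div_ne_zero hd0)).symm (fun r => by simp [hL])⟩
  · rintro ⟨L, hL, hQ⟩
    obtain ⟨Pi, -, -, hPi, -⟩ := exists_isSICSet_of_hasQQTProperty hd L hL hQ
    exact ⟨_, Pi, hPi, fun _ => rfl⟩
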